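/- Let $p$ be a prime and let $k\ge 1$ be an integer. For a finite multiset $S$ of elements of $\mathbb{Z}_p^k$, let $$\Sigma(S)=\Big\{\sum_{t\in T}t \;:\; T\subseteq S\Big\}$$ be the set of all sums of sub-multisets of $S$ (the empty sum being $0$), and call $S$ reduced if $|\Sigma(S)|>|\Sigma(S-\{s\})|$ for every $s\in S$, where $S-\{s\}$ is $S$ with one copy of $s$ removed. Then there is a largest size $h_p(k)$ of a reduced multiset in $\mathbb{Z}_p^k$, and $$h_p(k)\le (p-1)(\log_2 k+1)\,k .$$ -/

import Mathlib

/-- The sumset of a multiset `S` in an abelian group: the set of all sums of sub-multisets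
of `S` (counted with multiplicity), the empty sum being `0`. -/
def sumset {A : Type*} [AddCommGroup A] (S : Multiset A) : Set A :=
  {a | ∃ T : Multiset A, T ≤ S ∧ T.sum = a}

/-- `S` is reduced if removing one copy of any of its elements strictly decreases the number of
subset sums. Sumsets are always finite, so `Set.ncard` is the true cardinality. -/
def IsReducedMultiset {A : Type*} [AddCommGroup A] [DecidableEq A] (S : Multiset A) : Prop :=
  ∀ s ∈ S, (sumset (S - {s})).ncard < (sumset S).ncard

/-- The set of all sizes of reduced multisets in `ℤ_p^k`. -/
def reducedSizes (p k : ℕ) : Set ℕ :=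
  {n | ∃ S : Multiset (Fin k → ZMod p), IsReducedMultiset S ∧ Multiset.card S = n}

/-- The size `h_p(k)` of a largest reduced multiset in `ℤ_p^k`. -/
noncomputable def maxReducedSize (p k : ℕ) : ℕ :=
  sSup (reducedSizes p k)

/-!
A reduced multiset `S` in `V = ℤ_p^k` cannot contain a redundant element, and redundancy is produced
by two independent facts.

*Packing.* If `S` has more than `m k` elements, then some subspace `W` is spanned by each of `m`
disjoint parts of `S`, of at most `k` elements each, and contains a further element `s` of `S`
(`exists_disjoint_spanning_families`). Take `m` disjoint independent parts `I_j` of `S` with as many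
elements as possible in total, and let `W` be the largest subspace that is spanned by `I_j ∩ W` for
every `j`. It is the limit of a decreasing chain of subspaces, and an element of `S` outside all the
`I_j` that leaves this chain would start a series of exchanges that ends in a larger packing
(`IsIndepColoring.exists_card_lt`).

*Additive bases.* If `m` is large, the sums of distinct elements of `m` spanning sets of `W` fill `W`
(`exists_sum_eq_of_mem_of_span_eq`); this is a theorem of Alon, Linial and Meshulam. In the group
algebra `𝔽_p[V]`, let `I` be the ideal generated by the elements `X ^ w - 1` with `w ∈ W`. Each of the
spanning sets gives generators `X ^ b - 1` of `I`, with vanishing `p`-th powers. If `f ≠ 0` is killed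
by `I ^ (r + 1)` with `r` minimal, then some product of `r` of the generators from one spanning
set does not kill `f`, and at least `r / (p - 1)` different generators occur in it. Multiplying `f` by
these, once each, reduces `r` to at most `r (p - 2) / (p - 1)`
(`exists_subset_annihilator_step`). Starting from `f = 1` and
`r ≤ k (p - 1)`, and using one spanning set at a time, `r = 0` is reached once
`m = ⌊(p - 1) log₂ k⌋ + (p - 1)` (`iterate_greedy_step_eq_zero`). Then `f` is a nonzero element
invariant under translation by `W`, so its support is all of `W`; and the support of
`f = ∏ (X ^ b - 1)` consists of subset sums.

With this `m`, if `S` has more than `m k` elements, then the subset sums of the `m` parts fill `W`, so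
the further element `s ∈ W` can be dropped without losing a subset sum
(`not_isReducedMultiset_of_subspace`). Hence a reduced multiset has at most
`m k ≤ (p - 1) (log₂ k + 1) k` elements.
-/

/-! ### Packing independent sets -/

section Packing

variable {K V ι : Type*} [Field K] [AddCommGroup V] [Module K V] {m : ℕ}

/-- A partial colouring `c` of the index set of a family `v` (where `c i = none` means that `i` is
uncoloured) whose colour classes are linearly independent: `m` disjoint independent subfamilies. -/
def IsIndepColoring (K : Type*) [Field K] {V ι : Type*} [AddCommGroup V] [Module K V] {m : ℕ}
    (v : ι → V) (c : ι → Option (Fin m)) : Prop :=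
  ∀ j, LinearIndepOn K v {i | c i = some j}

/-- The subspaces obtained from the whole space by repeatedly replacing `W` with the intersection,
over all colours, of the span of the vectors of that colour lying in `W`. -/
def colorChain (K : Type*) [Field K] {V ι : Type*} [AddCommGroup V] [Module K V] {m : ℕ}
    (v : ι → V) (c : ι → Option (Fin m)) : ℕ → Submodule K V
  | 0 => ⊤
  | i + 1 => ⨅ j, Submodule.span K (v '' {x | c x = some j ∧ v x ∈ colorChain K v c i})

theorem colorChain_succ_le (v : ι → V) (c : ι → Option (Fin m)) (i : ℕ) :
    colorChain K v c (i + 1) ≤ colorChain K v c i := by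
  induction i with
  | zero => exact le_top
  | succ i ih =>
    rw [colorChain, colorChain]
    exact iInf_mono fun j => Submodule.span_mono <| Set.image_mono fun x hx => ⟨hx.1, ih hx.2⟩

theorem colorChain_antitone (v : ι → V) (c : ι → Option (Fin m)) :
    Antitone (colorChain K v c) :=
  antitone_nat_of_succ_le (colorChain_succ_le v c)

/-- If `v s` lies in the span of an independent family but not in the span of its members
inside `W`, then some member outside `W` can be exchanged for `s`. -/
theorem exists_exchange_notMem {v : ι → V} {A : Set ι} (hA : LinearIndepOn K v A)
    (W : Submodule K V) {s : ι} (hs : v s ∈ Submodule.span K (v '' A))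
    (hsW : v s ∉ Submodule.span K (v '' {x | x ∈ A ∧ v x ∈ W})) :
    ∃ x ∈ A, v x ∉ W ∧ v s ∉ Submodule.span K (v '' (A \ {x})) := by
  classical
  obtain ⟨l, hl, hls⟩ := (Finsupp.mem_span_image_iff_linearCombination K).1 hs
  obtain ⟨x, hx, hxW⟩ : ∃ x ∈ l.support, v x ∉ W := by
    by_contra! h
    refine hsW ((Finsupp.mem_span_image_iff_linearCombination K).2 ⟨l, ?_, hls⟩)
    exact (Finsupp.mem_supported K l).2 fun x hx => ⟨(Finsupp.mem_supported K l).1 hl hx, h x hx⟩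
  have hxA : x ∈ A := (Finsupp.mem_supported K l).1 hl hx
  refine ⟨x, hxA, hxW, fun hmem => ?_⟩
  have hrest : Finsupp.linearCombination K v (l.erase x) ∈ Submodule.span K (v '' (A \ {x})) := by
    refine (Finsupp.mem_span_image_iff_linearCombination K).2 ⟨_, ?_, rfl⟩
    refine (Finsupp.mem_supported K _).2 fun y hy => ?_
    rw [Finset.mem_coe, Finsupp.support_erase, Finset.mem_erase] at hy
    exact ⟨(Finsupp.mem_supported K l).1 hl hy.2, hy.1⟩
  have hsum : v s = l x • v x + Finsupp.linearCombination K v (l.erase x) := by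
    rw [← hls]
    conv_lhs => rw [← Finsupp.single_add_erase x l]
    rw [map_add, Finsupp.linearCombination_single]
  have hxs : l x • v x ∈ Submodule.span K (v '' (A \ {x})) := by
    rw [eq_sub_of_add_eq hsum.symm]
    exact Submodule.sub_mem _ hmem hrest
  rw [Submodule.smul_mem_iff _ (Finsupp.mem_support_iff.1 hx)] at hxs
  have : LinearIndepOn K v (insert x (A \ {x})) := by simpa [Set.insert_eq_of_mem hxA] using hA
  rw [linearIndepOn_insert (by simp)] at this
  exact this.2 hxs

variable [Fintype ι]

/-- An uncoloured index whose vector leaves the chain at some stage allows more indices to be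
coloured. If the vector is in the span of every class, exchange it for a member of a class that
leaves the chain at an earlier stage; the first stages of the chain do not grow under the
exchange, so the argument can be repeated with the index that has just been uncoloured. -/
theorem IsIndepColoring.exists_card_lt {v : ι → V} (n : ℕ) {c : ι → Option (Fin m)}
    (hc : IsIndepColoring K v c) {s : ι} (hs : c s = none) (hsn : v s ∉ colorChain K v c n) :
    ∃ c' : ι → Option (Fin m), IsIndepColoring K v c' ∧
      Fintype.card {i // c i ≠ none} < Fintype.card {i // c' i ≠ none} := by
  classical
  induction n generalizing c s with
  | zero => exact absurd Submodule.mem_top hsn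
  | succ n ih =>
    by_cases hsW : v s ∈ colorChain K v c n
    swap
    · exact ih hc hs hsW
    obtain ⟨j, hj⟩ : ∃ j, v s ∉
        Submodule.span K (v '' {x | c x = some j ∧ v x ∈ colorChain K v c n}) := by
      by_contra! h
      exact hsn (by rw [colorChain]; exact (Submodule.mem_iInf _).2 h)
    by_cases hspan : v s ∈ Submodule.span K (v '' {i | c i = some j})
    swap
    · refine ⟨Function.update c s (some j), fun j' => ?_, ?_⟩
      · by_cases hjj : j' = j
        · subst hjj
          refine ((hc j').insert hspan).mono fun i hi => ?_
          by_cases his : i = s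
          · exact Or.inl his
          · exact Or.inr (by simpa [his] using hi)
        · refine (hc j').mono fun i hi => ?_
          by_cases his : i = s
          · subst his
            simp [Ne.symm hjj] at hi
          · simpa [his] using hi
      · rw [Fintype.card_subtype, Fintype.card_subtype]
        refine Finset.card_lt_card (Finset.ssubset_iff_of_subset ?_ |>.2 ⟨s, by simp, by simp [hs]⟩)
        intro i hi
        by_cases his : i = s
        · simp [his]
        · simpa [his] using hi
    · obtain ⟨x, hxj, hxW, hxs⟩ := exists_exchange_notMem (hc j) _ hspan hj
      have hxj' : c x = some j := hxj
      have hne : s ≠ x := by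
        rintro rfl
        simp [hs] at hxj'
      set c' := Function.update (Function.update c s (some j)) x none with hc'
      have hx' : c' x = none := by simp [hc']
      have hs' : c' s = some j := by simp [hc', hne]
      have hoff : ∀ i, i ≠ s → i ≠ x → c' i = c i := fun i h1 h2 => by simp [hc', h1, h2]
      have hindep : IsIndepColoring K v c' := by
        intro j'
        by_cases hjj : j' = j
        · subst hjj
          refine (((hc j').mono Set.sdiff_subset).insert hxs).mono fun i hi => ?_
          have hi' : c' i = some j' := hi
          by_cases his : i = s
          · exact Or.inl his
          · have hix : i ≠ x := by
              rintro rfl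
              simp [hx'] at hi'
            exact Or.inr ⟨by simpa [hoff i his hix] using hi', hix⟩
        · refine (hc j').mono fun i hi => ?_
          have hi' : c' i = some j' := hi
          have his : i ≠ s := by
            rintro rfl
            rw [hs', Option.some_inj] at hi'
            exact hjj hi'.symm
          have hix : i ≠ x := by
            rintro rfl
            simp [hx'] at hi'
          simpa [hoff i his hix] using hi'
      have hchain : ∀ l ≤ n, colorChain K v c' l ≤ colorChain K v c l := by
        intro l hl
        induction l with
        | zero => exact le_top
        | succ l ihl =>
          have ihl := ihl (by omega)
          have hsl : v s ∈ colorChain K v c (l + 1) := colorChain_antitone v c hl hsW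
          rw [colorChain] at hsl ⊢
          rw [colorChain]
          refine iInf_mono fun j' => Submodule.span_le.2 ?_
          rintro _ ⟨i, ⟨hi, hiW⟩, rfl⟩
          by_cases his : i = s
          · subst his
            exact (Submodule.mem_iInf _).1 hsl j'
          · have hix : i ≠ x := by
              rintro rfl
              simp [hx'] at hi
            exact Submodule.subset_span ⟨i, ⟨by rw [← hoff i his hix, hi], ihl hiW⟩, rfl⟩
      obtain ⟨c'', hc'', hlt⟩ := ih hindep hx' fun h => hxW (hchain n le_rfl h)
      refine ⟨c'', hc'', lt_of_eq_of_lt ?_ hlt⟩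
      rw [Fintype.card_subtype, Fintype.card_subtype]
      have hset : insert x ((Finset.univ.filter fun i => c' i ≠ none).erase s) =
          Finset.univ.filter fun i => c i ≠ none := by
        ext i
        by_cases his : i = s
        · simp [his, hne, hs]
        · by_cases hix : i = x
          · simp [hix, hxj']
          · simp [his, hix, hoff i his hix]
      rw [← hset, Finset.card_insert_of_notMem (by simp [hx']),
        Finset.card_erase_add_one (by simp [hs'])]

/-- If a family has more than `m * dim V` members, then there are `m` disjoint subfamilies, each of
at most `dim V` members, that span the same subspace `W`, and a further member in `W`. -/
theorem exists_disjoint_spanning_families [FiniteDimensional K V] (v : ι → V)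
    (hcard : m * Module.finrank K V < Fintype.card ι) :
    ∃ (W : Submodule K V) (B : Fin m → Finset ι) (s : ι), v s ∈ W ∧
      (∀ j, s ∉ B j) ∧ Pairwise (fun i j => Disjoint (B i) (B j)) ∧
      (∀ j, (B j).card ≤ Module.finrank K V) ∧
      ∀ j, Submodule.span K (v '' (B j : Set ι)) = W := by
  classical
  obtain ⟨c, hc, hmax⟩ : ∃ c : ι → Option (Fin m), IsIndepColoring K v c ∧
      ∀ c' : ι → Option (Fin m), IsIndepColoring K v c' →
        Fintype.card {i // c' i ≠ none} ≤ Fintype.card {i // c i ≠ none} := by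
    obtain ⟨c, hc, hmax⟩ := Set.exists_max_image {c : ι → Option (Fin m) | IsIndepColoring K v c}
      (fun c => Fintype.card {i // c i ≠ none}) (Set.toFinite _)
      ⟨fun _ => none, fun j => by simp⟩
    exact ⟨c, hc, hmax⟩
  have hclass : ∀ j, (Finset.univ.filter fun i => c i = some j).card ≤ Module.finrank K V := by
    intro j
    have h := (hc j).linearIndependent.fintype_card_le_finrank
    rwa [Fintype.card_subtype] at h
  obtain ⟨s, hs⟩ : ∃ s, c s = none := by
    by_contra! h
    have : (Finset.univ : Finset ι) =
        (Finset.univ : Finset (Fin m)).biUnion fun j => Finset.univ.filter fun i => c i = some j := by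
      ext i
      simpa using Option.ne_none_iff_exists'.1 (h i)
    have h2 : Fintype.card ι ≤ m * Module.finrank K V := by
      rw [← Finset.card_univ, this]
      simpa using Finset.card_biUnion_le_card_mul (Finset.univ : Finset (Fin m))
        (fun j => Finset.univ.filter fun i => c i = some j) _ fun j _ => hclass j
    omega
  obtain ⟨n, hn⟩ := IsArtinian.monotone_stabilizes
    (⟨fun i => OrderDual.toDual (colorChain K v c i), fun a b hab => colorChain_antitone v c hab⟩ :
      ℕ →o (Submodule K V)ᵒᵈ)
  have hfix : colorChain K v c n = colorChain K v c (n + 1) := hn (n + 1) (by omega)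
  refine ⟨colorChain K v c n,
    fun j => Finset.univ.filter fun i => c i = some j ∧ v i ∈ colorChain K v c n, s,
    ?_, by simp [hs], ?_, ?_, ?_⟩
  · by_contra h
    obtain ⟨c', hc', hlt⟩ := hc.exists_card_lt n hs h
    exact absurd (hmax c' hc') (not_le.2 hlt)
  · intro i j hij
    refine Finset.disjoint_left.2 fun x hx hx' => hij ?_
    simp only [Finset.mem_filter, Finset.mem_univ, true_and] at hx hx'
    exact Option.some_inj.1 (hx.1.symm.trans hx'.1)
  · exact fun j => (Finset.card_le_card fun i hi => by simp_all).trans (hclass j)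
  · intro j
    refine le_antisymm (Submodule.span_le.2 ?_) ?_
    · rintro _ ⟨i, hi, rfl⟩
      simp only [Finset.coe_filter, Finset.mem_univ, true_and, Set.mem_ofPred_eq] at hi
      exact hi.2
    · conv_lhs => rw [hfix, colorChain]
      refine (iInf_le _ j).trans (Submodule.span_mono (Set.image_mono fun i hi => ?_))
      simpa using hi

end Packing

/-! ### Products of nilpotent generators of an ideal -/

section Nilpotent

variable {A ι : Type*} [CommRing A] {p : ℕ}

open scoped Pointwise in
/-- If `I ^ q` does not annihilate `f`, then `f` is not annihilated by some product of `q` of the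
generators. As no generator can be used `p` times, at least `q / (p - 1)` different ones occur. -/
theorem exists_subset_mul_prod_ne_zero {I : Ideal A} {x : ι → A} {s : Finset ι}
    (hI : I = Ideal.span (x '' (s : Set ι))) (hx : ∀ i ∈ s, x i ^ p = 0) {f : A} {q : ℕ}
    (hf : ∃ g ∈ I ^ q, f * g ≠ 0) :
    ∃ J ⊆ s, J.card ≤ q ∧ q ≤ J.card * (p - 1) ∧ f * ∏ i ∈ J, x i ≠ 0 := by
  classical
  obtain ⟨φ, hφs, hφ⟩ : ∃ φ : Fin q → ι, (∀ t, φ t ∈ s) ∧ f * ∏ t, x (φ t) ≠ 0 := by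
    by_contra! h
    obtain ⟨g, hg, hfg⟩ := hf
    rw [hI, show Ideal.span (x '' (s : Set ι)) ^ q = Ideal.span ((x '' (s : Set ι)) ^ q) from
      Submodule.span_pow _ _] at hg
    refine hfg ?_
    clear hfg
    induction hg using Submodule.span_induction with
    | mem g hg =>
      obtain ⟨y, rfl⟩ := Set.mem_pow.1 hg
      choose φ hφ using fun t => (y t).2
      rw [List.prod_ofFn]
      simpa [(hφ _).2] using h φ fun t => (hφ t).1
    | zero => simp
    | add a b _ _ ha hb => rw [mul_add, ha, hb, add_zero]
    | smul a b _ hb => rw [smul_eq_mul, mul_left_comm, hb, mul_zero]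
  have hprod : ∏ t, x (φ t) =
      ∏ i ∈ Finset.univ.image φ, x i ^ (Finset.univ.filter fun t => φ t = i).card :=
    Finset.prod_comp x φ
  refine ⟨Finset.univ.image φ, fun i hi => ?_, ?_, ?_, fun h0 => hφ ?_⟩
  · obtain ⟨t, -, rfl⟩ := Finset.mem_image.1 hi
    exact hφs t
  · simpa using Finset.card_image_le (s := (Finset.univ : Finset (Fin q))) (f := φ)
  · have hfib : ∀ i ∈ Finset.univ.image φ,
        (Finset.univ.filter fun t => φ t = i).card ≤ p - 1 := by
      intro i hi
      by_contra! hlt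
      refine hφ ?_
      rw [hprod, Finset.prod_eq_zero hi, mul_zero]
      obtain ⟨t, -, rfl⟩ := Finset.mem_image.1 hi
      exact pow_eq_zero_of_le (by omega) (hx _ (hφs t))
    simpa [mul_comm] using Finset.card_le_mul_card_image (f := φ) Finset.univ (p - 1) hfib
  · have hdvd : ∏ i ∈ Finset.univ.image φ, x i ∣ ∏ t, x (φ t) := by
      rw [hprod]
      refine Finset.prod_dvd_prod_of_dvd _ _ fun i hi => dvd_pow_self _ ?_
      obtain ⟨t, -, rfl⟩ := Finset.mem_image.1 hi
      exact Finset.card_ne_zero.2 ⟨t, by simp⟩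
    obtain ⟨z, hz⟩ := hdvd
    rw [hz, ← mul_assoc, h0, zero_mul]

/-- One step of the greedy argument: if `I ^ (r + 1)` annihilates `f ≠ 0`, then multiplying `f` by
suitable distinct generators of `I` keeps it nonzero and reduces `r` by the factor
`(p - 2) / (p - 1)`. -/
theorem exists_subset_annihilator_step (hp : 2 ≤ p) {I : Ideal A} {x : ι → A} {s : Finset ι}
    (hI : I = Ideal.span (x '' (s : Set ι))) (hx : ∀ i ∈ s, x i ^ p = 0) {f : A} (hf : f ≠ 0)
    {r : ℕ} (hr : ∀ g ∈ I ^ (r + 1), f * g = 0) :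
    ∃ J ⊆ s, f * ∏ i ∈ J, x i ≠ 0 ∧
      ∀ g ∈ I ^ ((p - 2) * r / (p - 1) + 1), f * (∏ i ∈ J, x i) * g = 0 := by
  classical
  -- `n` is least with `f * I ^ (n + 1) = 0`, so that `f * I ^ n ≠ 0`.
  have hex : ∃ n, ∀ g ∈ I ^ (n + 1), f * g = 0 := ⟨r, hr⟩
  set n := Nat.find hex with hn
  have hnr : n ≤ r := Nat.find_min' hex hr
  have hne : ∃ g ∈ I ^ n, f * g ≠ 0 := by
    rcases Nat.eq_zero_or_pos n with h0 | h0
    · exact ⟨1, by simp [h0], by simpa using hf⟩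
    · have := Nat.find_min hex (m := n - 1) (by omega)
      push Not at this
      rwa [Nat.sub_add_cancel h0] at this
  obtain ⟨J, hJs, hJn, hnJ, hJ⟩ := exists_subset_mul_prod_ne_zero hI hx hne
  refine ⟨J, hJs, hJ, fun g hg => ?_⟩
  have hle : n - J.card ≤ (p - 2) * r / (p - 1) := by
    rw [Nat.le_div_iff_mul_le (by omega)]
    obtain ⟨d, rfl⟩ := Nat.exists_eq_add_of_le hp
    obtain ⟨e, he⟩ := Nat.exists_eq_add_of_le hJn
    have h1 : 2 + d - 1 = d + 1 := by omega
    have h2 : 2 + d - 2 = d := by omega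
    have h3 : n - J.card = e := by omega
    rw [h1] at hnJ
    rw [h1, h2, h3]
    nlinarith [Nat.mul_le_mul_left d hnr]
  have hJI : ∏ i ∈ J, x i ∈ I ^ J.card := by
    rw [← Finset.prod_const]
    refine Ideal.prod_mem_prod fun i hi => ?_
    rw [hI]
    exact Ideal.subset_span ⟨i, hJs hi, rfl⟩
  rw [mul_assoc]
  refine Nat.find_spec hex _ (Ideal.pow_le_pow_right
    (n := J.card + ((p - 2) * r / (p - 1) + 1)) (by omega) ?_)
  rw [pow_add]
  exact Ideal.mul_mem_mul hJI hg

/-- If an ideal `I` is generated by each of sufficiently many families of at most `k` elements with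
vanishing `p`-th powers, then some product of distinct members of these families is a nonzero
element annihilated by `I`. -/
theorem exists_prod_ne_zero_mul_eq_zero [Nontrivial A] (hp : 2 ≤ p) {k m : ℕ} {I : Ideal A}
    {x : ι → A} {B : Fin m → Finset ι} (hm : 0 < m)
    (hB : Pairwise fun i j => Disjoint (B i) (B j)) (hk : ∀ j, (B j).card ≤ k)
    (hI : ∀ j, I = Ideal.span (x '' (B j : Set ι))) (hx : ∀ j, ∀ i ∈ B j, x i ^ p = 0)
    (hr : (fun r => (p - 2) * r / (p - 1))^[m] (k * (p - 1)) = 0) :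
    ∃ T : Finset ι, (∀ i ∈ T, ∃ j, i ∈ B j) ∧ ∏ i ∈ T, x i ≠ 0 ∧
      ∀ g ∈ I, (∏ i ∈ T, x i) * g = 0 := by
  classical
  have key : ∀ t : Finset (Fin m), ∃ T ⊆ t.biUnion B, ∏ i ∈ T, x i ≠ 0 ∧
      ∀ g ∈ I ^ ((fun r => (p - 2) * r / (p - 1))^[t.card] (k * (p - 1)) + 1),
        (∏ i ∈ T, x i) * g = 0 := by
    intro t
    induction t using Finset.induction_on with
    | empty =>
      refine ⟨∅, by simp, by simp, fun g hg => ?_⟩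
      by_contra hne
      obtain ⟨J, hJ, -, hcard, -⟩ := exists_subset_mul_prod_ne_zero (hI ⟨0, hm⟩) (hx _)
        ⟨g, hg, hne⟩
      have := Nat.mul_le_mul_right (p - 1) ((Finset.card_le_card hJ).trans (hk _))
      simp only [Finset.card_empty, Function.iterate_zero, id_eq] at hcard
      omega
    | insert j t hj ih =>
      obtain ⟨T, hT, hne, hann⟩ := ih
      obtain ⟨J, hJ, hne', hann'⟩ := exists_subset_annihilator_step hp (hI j) (hx j) hne hann
      have hdisj : Disjoint T J := by
        refine Finset.disjoint_of_subset_left hT (Finset.disjoint_of_subset_right hJ ?_)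
        refine (Finset.disjoint_biUnion_left _ _ _).2 fun i hi => hB ?_
        rintro rfl
        exact hj hi
      refine ⟨T ∪ J, ?_, ?_, ?_⟩
      · rw [Finset.biUnion_insert, Finset.union_comm T J]
        exact Finset.union_subset_union hJ hT
      · rwa [Finset.prod_union hdisj]
      · rw [Finset.prod_union hdisj, Finset.card_insert_of_notMem hj, Function.iterate_succ_apply']
        exact hann'
  obtain ⟨T, hT, hne, hann⟩ := key Finset.univ
  refine ⟨T, fun i hi => by simpa using hT hi, hne, ?_⟩
  rw [Finset.card_fin, hr, zero_add, pow_one] at hann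
  exact hann

end Nilpotent

/-! ### Subset sums of several spanning families -/

section GroupAlgebra

open AddMonoidAlgebra

variable {p : ℕ} {V ι : Type*} [AddCommGroup V]

/-- The ideal generated by the elements `X ^ w - 1` for `w` in a subspace is generated by those with
`w` in a spanning set. -/
theorem span_single_sub_one_image_span [Module (ZMod p) V] (b : ι → V) (s : Set ι) :
    Ideal.span ((fun w : V => (single w 1 - 1 : AddMonoidAlgebra (ZMod p) V)) ''
      (Submodule.span (ZMod p) (b '' s) : Set V)) =
    Ideal.span ((fun i => (single (b i) 1 - 1 : AddMonoidAlgebra (ZMod p) V)) '' s) := by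
  set I := Ideal.span ((fun i => (single (b i) 1 - 1 : AddMonoidAlgebra (ZMod p) V)) '' s) with hI
  refine le_antisymm (Ideal.span_le.2 ?_) (Ideal.span_mono ?_)
  · -- The `w` with `X ^ w - 1 ∈ I` form a subgroup, hence a subspace over the prime field.
    let H : AddSubgroup V :=
      { carrier := {w | single w 1 - 1 ∈ I}
        zero_mem' := by simp [← one_def]
        add_mem' := by
          intro u w hu hw
          have : (single (u + w) 1 - 1 : AddMonoidAlgebra (ZMod p) V) =
              single u 1 * (single w 1 - 1) + (single u 1 - 1) := by
            rw [mul_sub, single_mul_single]; simp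
          rw [Set.mem_ofPred_eq, this]
          exact I.add_mem (I.mul_mem_left _ hw) hu
        neg_mem' := by
          intro u hu
          have : (single (-u) 1 - 1 : AddMonoidAlgebra (ZMod p) V) =
              -(single (-u) 1 * (single u 1 - 1)) := by
            rw [mul_sub, single_mul_single]; simp [← one_def]
          rw [Set.mem_ofPred_eq, this]
          exact I.neg_mem (I.mul_mem_left _ hu) }
    have hle : Submodule.span (ZMod p) (b '' s) ≤ AddSubgroup.toZModSubmodule p H := by
      refine Submodule.span_le.2 ?_
      rintro _ ⟨i, hi, rfl⟩
      exact Ideal.subset_span ⟨i, hi, rfl⟩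
    rintro _ ⟨w, hw, rfl⟩
    exact hle hw
  · rintro _ ⟨i, hi, rfl⟩
    exact ⟨b i, Submodule.subset_span ⟨i, hi, rfl⟩, rfl⟩

theorem single_sub_one_pow_char [Fact p.Prime] [Module (ZMod p) V] (w : V) :
    (single w 1 - 1 : AddMonoidAlgebra (ZMod p) V) ^ p = 0 := by
  have : CharP (AddMonoidAlgebra (ZMod p) V) p :=
    charP_of_injective_algebraMap (algebraMap (ZMod p) (AddMonoidAlgebra (ZMod p) V)).injective p
  rw [sub_pow_char, one_pow, single_pow, one_pow, ← Nat.cast_smul_eq_nsmul (ZMod p)]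
  simp [← one_def]

/-- Expanding `∏ i ∈ T, (X ^ (b i) - 1)` only produces exponents that are subset sums. -/
theorem exists_sum_eq_of_coeff_prod_ne_zero (b : ι → V) (T : Finset ι) {w : V}
    (hw : (∏ i ∈ T, (single (b i) 1 - 1 : AddMonoidAlgebra (ZMod p) V)).coeff w ≠ 0) :
    ∃ F ⊆ T, ∑ i ∈ F, b i = w := by
  classical
  induction T using Finset.induction_on generalizing w with
  | empty =>
    refine ⟨∅, subset_rfl, ?_⟩
    by_contra h
    exact hw (by simp [one_def, show (0 : V) ≠ w by simpa using h])
  | insert j T hj ih =>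
    rw [Finset.prod_insert hj, sub_mul, one_mul] at hw
    by_cases h : (∏ i ∈ T, (single (b i) 1 - 1 : AddMonoidAlgebra (ZMod p) V)).coeff w = 0
    · rw [coeff_sub, Finsupp.sub_apply, h, sub_zero, coeff_single_mul_apply, one_mul] at hw
      obtain ⟨F, hF, hs⟩ := ih hw
      refine ⟨insert j F, Finset.insert_subset_insert _ hF, ?_⟩
      rw [Finset.sum_insert fun h' => hj (hF h'), hs]
      abel
    · obtain ⟨F, hF, hs⟩ := ih h
      exact ⟨F, hF.trans (Finset.subset_insert _ _), hs⟩

/-- If sufficiently many disjoint families of at most `k` vectors span the same subspace `W`, then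
every vector of `W` is a sum of distinct members of these families. -/
theorem exists_sum_eq_of_mem_of_span_eq [Fact p.Prime] [Module (ZMod p) V] {k m : ℕ}
    {W : Submodule (ZMod p) V}
    {b : ι → V} {B : Fin m → Finset ι} (hm : 0 < m)
    (hB : Pairwise fun i j => Disjoint (B i) (B j)) (hk : ∀ j, (B j).card ≤ k)
    (hW : ∀ j, Submodule.span (ZMod p) (b '' (B j : Set ι)) = W)
    (hr : (fun r => (p - 2) * r / (p - 1))^[m] (k * (p - 1)) = 0) {w : V} (hw : w ∈ W) :
    ∃ F : Finset ι, (∀ i ∈ F, ∃ j, i ∈ B j) ∧ ∑ i ∈ F, b i = w := by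
  obtain ⟨T, hT, hne, hann⟩ := exists_prod_ne_zero_mul_eq_zero (p := p)
    (I := Ideal.span ((fun w : V => (single w 1 - 1 : AddMonoidAlgebra (ZMod p) V)) '' (W : Set V)))
    (x := fun i => (single (b i) 1 - 1 : AddMonoidAlgebra (ZMod p) V))
    (Fact.out : p.Prime).two_le hm hB hk
    (fun j => by rw [← hW j, span_single_sub_one_image_span])
    (fun _ i _ => single_sub_one_pow_char (b i)) hr
  -- The product `f` is invariant under translation by `W`, so its support contains a coset of `W`;
  -- as its support is contained in `W`, it is all of `W`.
  set f := ∏ i ∈ T, (single (b i) 1 - 1 : AddMonoidAlgebra (ZMod p) V) with hf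
  have hinv : ∀ u ∈ W, ∀ a, f.coeff (a + u) = f.coeff a := by
    intro u hu a
    have h := hann _ (Ideal.subset_span ⟨u, hu, rfl⟩)
    rw [mul_sub, mul_one, sub_eq_zero] at h
    rw [← h, coeff_mul_single_apply]
    simp [h]
  obtain ⟨a, ha⟩ : ∃ a, f.coeff a ≠ 0 := by
    by_contra! h
    exact hne (by ext a; simpa using h a)
  have haW : a ∈ W := by
    obtain ⟨F, hF, rfl⟩ := exists_sum_eq_of_coeff_prod_ne_zero b T ha
    refine Submodule.sum_mem _ fun i hi => ?_
    obtain ⟨j, hj⟩ := hT i (hF hi)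
    rw [← hW j]
    exact Submodule.subset_span ⟨i, hj, rfl⟩
  have hwf : f.coeff w ≠ 0 := by
    rwa [← add_sub_cancel a w, hinv _ (W.sub_mem hw haW)]
  obtain ⟨F, hF, hs⟩ := exists_sum_eq_of_coeff_prod_ne_zero b T hwf
  exact ⟨F, fun i hi => hT i (hF hi), hs⟩

end GroupAlgebra

/-! ### The number of greedy steps -/

/-- The recursion `r ↦ ⌊(p - 2) r / (p - 1)⌋` started at `k (p - 1)` drops below `p - 1` within
`n > (p - 1) log₂ k` steps by exponential decay; then it decreases by at least one per step. -/
theorem iterate_greedy_step_eq_zero {p k n : ℕ} (hp : 2 ≤ p) (hk : 1 ≤ k)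
    (hn : ((p : ℝ) - 1) * Real.logb 2 k < n) :
    (fun r => (p - 2) * r / (p - 1))^[n + (p - 2)] (k * (p - 1)) = 0 := by
  obtain ⟨d, rfl⟩ : ∃ d, p = d + 2 := ⟨p - 2, by omega⟩
  have h1 : d + 2 - 1 = d + 1 := by omega
  simp only [Nat.add_sub_cancel, h1]
  set step : ℕ → ℕ := fun r => d * r / (d + 1) with hstep
  have hd : (0 : ℝ) < d + 1 := by positivity
  have hk' : (1 : ℝ) ≤ k := by exact_mod_cast hk
  have hdecay : ∀ l : ℕ, ((step^[l] (k * (d + 1)) : ℕ) : ℝ) ≤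
      k * (d + 1) * Real.exp (-l / (d + 1)) := by
    intro l
    induction l with
    | zero => simp
    | succ l ih =>
      rw [Function.iterate_succ_apply', hstep]
      set r := step^[l] (k * (d + 1))
      have hfac : (d : ℝ) / (d + 1) ≤ Real.exp (-1 / (d + 1)) := by
        have := Real.add_one_le_exp (-1 / ((d : ℝ) + 1))
        refine le_trans (le_of_eq ?_) this
        field_simp
        ring
      calc ((d * r / (d + 1) : ℕ) : ℝ) ≤ ((d * r : ℕ) : ℝ) / ((d + 1 : ℕ) : ℝ) := Nat.cast_div_le
        _ = r * (d / (d + 1)) := by push_cast; ring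
        _ ≤ (k * (d + 1) * Real.exp (-l / (d + 1))) * Real.exp (-1 / (d + 1)) := by gcongr
        _ = k * (d + 1) * Real.exp (-(l + 1 : ℕ) / (d + 1)) := by
          rw [mul_assoc, ← Real.exp_add]
          congr 2
          push_cast
          ring
  have hlog : Real.log k < n / (d + 1) := by
    have h2 : Real.log k ≤ Real.logb 2 k := by
      rw [Real.logb, le_div_iff₀ (Real.log_pos one_lt_two)]
      have : Real.log 2 ≤ 1 := by linarith [Real.log_two_lt_d9]
      nlinarith [Real.log_nonneg hk']
    rw [lt_div_iff₀ hd]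
    push_cast at hn
    nlinarith
  have hsmall : step^[n] (k * (d + 1)) ≤ d := by
    have hexp : k * Real.exp (-n / (d + 1)) < 1 := by
      have hlt : Real.exp (-n / (d + 1)) < Real.exp (-Real.log k) := by
        rw [Real.exp_lt_exp, neg_div]
        linarith
      rw [Real.exp_neg, Real.exp_log (by linarith)] at hlt
      calc k * Real.exp (-n / (d + 1)) < k * (k : ℝ)⁻¹ := by gcongr
        _ = 1 := mul_inv_cancel₀ (by linarith)
    have : ((step^[n] (k * (d + 1)) : ℕ) : ℝ) < (d + 1 : ℕ) := by
      refine (hdecay n).trans_lt ?_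
      push_cast
      nlinarith
    exact Nat.lt_succ_iff.1 (by exact_mod_cast this)
  have hdrop : ∀ l, step^[l] (step^[n] (k * (d + 1))) ≤ d - l := by
    intro l
    induction l with
    | zero => simpa using hsmall
    | succ l ih =>
      rw [Function.iterate_succ_apply']
      set r := step^[l] (step^[n] (k * (d + 1)))
      rcases Nat.eq_zero_or_pos r with h0 | h0
      · simp [hstep, h0]
      · have : step r < r := by
          rw [hstep, Nat.div_lt_iff_lt_mul (by omega)]
          nlinarith
        omega
  rw [add_comm, Function.iterate_add_apply]
  simpa using hdrop d

/-! ### Reduced multisets -/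

section Reduced

variable {V : Type*} [AddCommGroup V]

theorem finite_sumset (S : Multiset V) : (sumset S).Finite := by
  classical
  refine (S.powerset.map Multiset.sum).toFinset.finite_toSet.subset ?_
  rintro _ ⟨T, hT, rfl⟩
  simpa using ⟨T, hT, rfl⟩

/-- If every element of a subspace `W` is a subset sum of a multiset `R`, then `s` is redundant in
any multiset whose part inside `W` contains `R + {s}`: the part inside `W` of a
sub-multiset can be replaced with a sub-multiset of `R` of the same sum. -/
theorem not_isReducedMultiset_of_subspace {K : Type*} [Field K] [Module K V] [DecidableEq V]
    (W : Submodule K V) [DecidablePred (· ∈ W)] {S R : Multiset V} {s : V}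
    (hR : ∀ w ∈ W, w ∈ sumset R) (hle : R + {s} ≤ S.filter (· ∈ W)) :
    ¬ IsReducedMultiset S := by
  intro hred
  have hsS : s ∈ S :=
    Multiset.mem_of_le ((Multiset.le_add_left {s} R).trans (hle.trans (Multiset.filter_le _ _)))
      (Multiset.mem_singleton_self s)
  refine (hred s hsS).not_ge (Set.ncard_le_ncard ?_ (finite_sumset _))
  rintro _ ⟨T, hT, rfl⟩
  have hTW : (T.filter (· ∈ W)).sum ∈ W :=
    W.toAddSubmonoid.multiset_sum_mem _ fun a ha => (Multiset.mem_filter.1 ha).2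
  obtain ⟨T', hT', hsum⟩ := hR _ hTW
  refine ⟨T' + T.filter (¬ · ∈ W), ?_, ?_⟩
  · refine le_tsub_of_add_le_right ?_
    rw [add_right_comm]
    calc T' + {s} + T.filter (¬ · ∈ W)
        ≤ S.filter (· ∈ W) + S.filter (¬ · ∈ W) :=
          add_le_add ((add_le_add_left hT' _).trans hle) (Multiset.filter_le_filter _ hT)
      _ = S := Multiset.filter_add_not _ _
  · rw [Multiset.sum_add, hsum, ← Multiset.sum_add, Multiset.filter_add_not]

/-- A multiset of more than `m * dim V` vectors over the prime field is not reduced, as soon as the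
greedy recursion reaches `0` in `m` steps. -/
theorem IsReducedMultiset.card_le_mul_finrank {p : ℕ} [Fact p.Prime] [Module (ZMod p) V]
    [FiniteDimensional (ZMod p) V] [DecidableEq V] {S : Multiset V} (hS : IsReducedMultiset S)
    {m : ℕ} (hm : 0 < m)
    (hr : (fun r => (p - 2) * r / (p - 1))^[m] (Module.finrank (ZMod p) V * (p - 1)) = 0) :
    S.card ≤ m * Module.finrank (ZMod p) V := by
  classical
  by_contra! hcard
  obtain ⟨l, rfl⟩ : ∃ l : List V, S = l := ⟨S.toList, S.coe_toList.symm⟩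
  obtain ⟨W, B, s, hsW, hsB, hB, hk, hW⟩ :=
    exists_disjoint_spanning_families (K := ZMod p) (m := m) l.get (by simpa using hcard)
  let U : Finset (Fin l.length) := Finset.univ.biUnion B
  have hsU : s ∉ U := by simpa [U] using hsB
  refine not_isReducedMultiset_of_subspace W (R := U.val.map l.get) (s := l.get s) ?_ ?_ hS
  · intro w hw
    obtain ⟨F, hF, hsum⟩ := exists_sum_eq_of_mem_of_span_eq hm hB hk hW hr hw
    refine ⟨F.val.map l.get, Multiset.map_le_map (Finset.val_le_iff.2 fun i hi => ?_), hsum⟩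
    simpa [U] using hF i hi
  · have hl : (l : Multiset V) = (Finset.univ : Finset (Fin l.length)).val.map l.get := by
      simp
    have hsub : insert s U ⊆ Finset.univ.filter fun i => l.get i ∈ W := by
      intro i hi
      rcases Finset.mem_insert.1 hi with rfl | hi
      · simpa using hsW
      · obtain ⟨j, -, hj⟩ := Finset.mem_biUnion.1 hi
        have : l.get i ∈ W := hW j ▸ Submodule.subset_span ⟨i, hj, rfl⟩
        simpa using this
    have h := Multiset.map_le_map (f := l.get) (Finset.val_le_iff.2 hsub)
    rw [Finset.insert_val_of_notMem hsU, Multiset.map_cons, ← Multiset.singleton_add,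
      add_comm] at h
    rw [hl, Multiset.filter_map]
    exact h

end Reduced

theorem mainTheorem4 (p k : ℕ) (hp : p.Prime) (hk : 1 ≤ k) :
    IsGreatest (reducedSizes p k) (maxReducedSize p k) ∧
      (maxReducedSize p k : ℝ) ≤ ((p : ℝ) - 1) * (Real.logb 2 (k : ℝ) + 1) * (k : ℝ) := by
  have : Fact p.Prime := ⟨hp⟩
  have hp2 := hp.two_le
  have hp1 : (1 : ℝ) ≤ p := by exact_mod_cast hp.one_le
  set n := ⌊((p : ℝ) - 1) * Real.logb 2 k⌋₊ + 1 with hn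
  have hfin : Module.finrank (ZMod p) (Fin k → ZMod p) = k := by simp
  have hle : ∀ N ∈ reducedSizes p k, N ≤ (n + (p - 2)) * k := by
    rintro _ ⟨S, hS, rfl⟩
    have h := hS.card_le_mul_finrank (p := p) (m := n + (p - 2)) (by omega) (by
      rw [hfin]
      exact iterate_greedy_step_eq_zero hp2 hk (by simpa [hn] using Nat.lt_floor_add_one _))
    rwa [hfin] at h
  have hmem : maxReducedSize p k ∈ reducedSizes p k :=
    Nat.sSup_mem ⟨0, 0, by simp [IsReducedMultiset], rfl⟩ ⟨_, hle⟩
  refine ⟨⟨hmem, fun N hN => le_csSup ⟨_, hle⟩ hN⟩, ?_⟩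
  have hlog : 0 ≤ ((p : ℝ) - 1) * Real.logb 2 k :=
    mul_nonneg (by linarith) (Real.logb_nonneg one_lt_two (by exact_mod_cast hk))
  calc (maxReducedSize p k : ℝ) ≤ ((n + (p - 2)) * k : ℕ) := by exact_mod_cast hle _ hmem
    _ = (⌊((p : ℝ) - 1) * Real.logb 2 k⌋₊ + ((p : ℝ) - 1)) * k := by
      rw [hn]
      push_cast [Nat.cast_sub hp2]
      ring
    _ ≤ (((p : ℝ) - 1) * Real.logb 2 k + ((p : ℝ) - 1)) * k := by
      gcongr
      exact Nat.floor_le hlog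
    _ = ((p : ℝ) - 1) * (Real.logb 2 (k : ℝ) + 1) * (k : ℝ) := by ring
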